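/- Let $0<\alpha<\pi/3$. For $h>0$ let $T^r(\cdot\,;h)$ denote the uniform trigonometric B-spline of order $r$ with mesh size $h$: $T^1(x;h)=1$ for $0\le x<h$ and $T^1(x;h)=0$ otherwise, and $$T^{r}(x;h)=\frac{\sin(x)\,T^{r-1}(x;h)+\sin(rh-x)\,T^{r-1}(x-h;h)}{\sin((r-1)h)}\qquad(r\ge 2).$$ For $k\ge 0$ and $i=0,1,2,3$ put $$a^{(k)}_i=T^4\!\left((3-i)\frac{\alpha}{2^k}+\frac{\alpha}{2^{k+2}}\,;\frac{\alpha}{2^k}\right)$$ (values of the cubic trigonometric B-spline). Consider the 4-point binary non-stationary approximating subdivision scheme which maps the control points $(f^k_i)_{i\in\mathbb Z}$, $f^k_i\in\mathbb R$, of level $k\ge 0$ to those of level $k+1$ by $$f^{k+1}_{2i}=a^{(k)}_0f^k_{i-1}+a^{(k)}_1f^k_{i}+a^{(k)}_2f^k_{i+1}+a^{(k)}_3f^k_{i+2},$$ $$f^{k+1}_{2i+1}=a^{(k)}_3f^k_{i-1}+a^{(k)}_2f^k_{i}+a^{(k)}_1f^k_{i+1}+a^{(k)}_0f^k_{i+2}.$$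 Then the scheme is convergent: for every bounded initial sequence $f^0\in\ell^\infty(\mathbb Z)$ there is a continuous limit function $g:\mathbb R\to\mathbb R$ with $\lim_{k\to\infty}\sup_{i\in\mathbb Z}|f^k_i-g(2^{-k}i)|=0$, and $g$ is not identically zero for some bounded $f^0$. Moreover, for every bounded initial sequence the limit function $g$ is of class $C^4(\mathbb R)$. -/

import Mathlib

open Filter

/-- The uniform trigonometric B-spline of degree `d` (that is, of order `r = d + 1`) with mesh size
`h` and knots `t_i = i * h`, given by its recurrence. The spline of degree `3` is the cubic one. -/
noncomputable def trigBSpline (h : ℝ) : ℕ → ℝ → ℝ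
  | 0, x => if 0 ≤ x ∧ x < h then 1 else 0
  | d + 1, x =>
      (Real.sin x * trigBSpline h d x
        + Real.sin (((d : ℝ) + 2) * h - x) * trigBSpline h d (x - h))
        / Real.sin (((d : ℝ) + 1) * h)

/-- The mask coefficients `a_i^{(k)}`, `i = 0, 1, 2, 3`, of the 4-point scheme with tension
parameter `α`: values of the cubic trigonometric B-spline with mesh size `α / 2 ^ k`. -/
noncomputable def fourPointMask (α : ℝ) (k : ℕ) (i : Fin 4) : ℝ :=
  trigBSpline (α / 2 ^ k) 3 ((3 - (i : ℝ)) * (α / 2 ^ k) + α / 2 ^ (k + 2))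

/-- One refinement step of a 4-point binary scheme with coefficients `a`:
`f⁺_{2i} = a_0 f_{i-1} + a_1 f_i + a_2 f_{i+1} + a_3 f_{i+2}` and
`f⁺_{2i+1} = a_3 f_{i-1} + a_2 f_i + a_1 f_{i+1} + a_0 f_{i+2}`. -/
noncomputable def fourPointRefine (a : Fin 4 → ℝ) (f : ℤ → ℝ) (n : ℤ) : ℝ :=
  if Even n then
    a 0 * f (n / 2 - 1) + a 1 * f (n / 2) + a 2 * f (n / 2 + 1) + a 3 * f (n / 2 + 2)
  else
    a 3 * f (n / 2 - 1) + a 2 * f (n / 2) + a 1 * f (n / 2 + 1) + a 0 * f (n / 2 + 2)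

/-- The 4-point binary non-stationary approximating scheme: its level-`k` refinement rule. -/
noncomputable def fourPointScheme (α : ℝ) (k : ℕ) : (ℤ → ℝ) → ℤ → ℝ :=
  fourPointRefine (fourPointMask α k)

/-- The control points at level `k` produced by the scheme `S` from the initial data `f₀`. -/
def controlPoints (S : ℕ → (ℤ → ℝ) → ℤ → ℝ) (f₀ : ℤ → ℝ) : ℕ → ℤ → ℝ
  | 0 => f₀
  | k + 1 => S k (controlPoints S f₀ k)

/-- `g` is a limit function of the scheme `S` for the initial data `f₀`: `g` is continuous and
`sup_i |f_i^k - g (2^{-k} i)|` tends to `0` as `k → ∞`. -/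
def IsLimitFunction (S : ℕ → (ℤ → ℝ) → ℤ → ℝ) (f₀ : ℤ → ℝ) (g : ℝ → ℝ) : Prop :=
  Continuous g ∧
    ∀ ε : ℝ, 0 < ε → ∀ᶠ k : ℕ in atTop, ∀ i : ℤ,
      |controlPoints S f₀ k i - g ((i : ℝ) / 2 ^ k)| ≤ ε

/-- Convergence of a binary subdivision scheme: every bounded initial sequence has a (continuous)
limit function, and for some bounded initial sequence the limit is not identically zero. -/
def IsConvergentScheme (S : ℕ → (ℤ → ℝ) → ℤ → ℝ) : Prop :=
  (∀ f₀ : ℤ → ℝ, Memℓp f₀ ⊤ → ∃ g : ℝ → ℝ, IsLimitFunction S f₀ g) ∧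
    ∃ (f₀ : ℤ → ℝ) (g : ℝ → ℝ), Memℓp f₀ ⊤ ∧ IsLimitFunction S f₀ g ∧ g ≠ 0

/-- All limit functions of the scheme (for bounded initial data) are of class `C^m`. -/
def HasSmoothLimits (m : ℕ) (S : ℕ → (ℤ → ℝ) → ℤ → ℝ) : Prop :=
  ∀ (f₀ : ℤ → ℝ) (g : ℝ → ℝ), Memℓp f₀ ⊤ → IsLimitFunction S f₀ g → ContDiff ℝ (m : ℕ∞) g

/-- The closed form of the mask coefficients. -/
theorem fourPointMask_eq {α : ℝ} (hα : 0 < α) (k : ℕ) {s : ℕ → ℝ} {D : ℝ}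
    (hs : ∀ n, s n = Real.sin (n * α / 2 ^ (k + 2)))
    (hD : D = Real.sin (α / 2 ^ k) * Real.sin (2 * α / 2 ^ k) * Real.sin (3 * α / 2 ^ k)) :
    fourPointMask α k 0 = s 3 ^ 3 / D ∧
    fourPointMask α k 1 = (s 3 ^ 2 * s 9 + s 3 * s 5 * s 7 + s 1 * s 7 ^ 2) / D ∧
    fourPointMask α k 2 = (s 3 * s 5 ^ 2 + s 1 * s 5 * s 7 + s 1 ^ 2 * s 11) / D ∧
    fourPointMask α k 3 = s 1 ^ 3 / D := by
  obtain ⟨u, hu⟩ : ∃ u, u = α / 2 ^ (k + 2) := ⟨_, rfl⟩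
  have hu0 : 0 < u := by rw [hu]; positivity
  have hk : α / 2 ^ k = 4 * u := by rw [hu, pow_add]; field_simp; norm_num
  have hs' : ∀ n, s n = Real.sin (n * u) := by intro n; rw [hs, hu, mul_div_assoc]
  have hD' : D = Real.sin (4 * u) * Real.sin (8 * u) * Real.sin (12 * u) := by
    rw [hD, mul_div_assoc, mul_div_assoc, hk]; ring_nf
  simp only [fourPointMask, hk, ← hu, hs', hD', trigBSpline]
  have e0 : (((0 : Fin 4) : ℕ) : ℝ) = 0 := by simp
  have e1 : (((1 : Fin 4) : ℕ) : ℝ) = 1 := by simp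
  have e2 : (((2 : Fin 4) : ℕ) : ℝ) = 2 := by simp
  have e3 : (((3 : Fin 4) : ℕ) : ℝ) = 3 := by simp
  rw [e0, e1, e2, e3]
  have c0 : (3 - 0) * (4 * u) + u = 13 * u := by ring
  have c1 : (3 - 1) * (4 * u) + u = 9 * u := by ring
  have c2 : (3 - 2) * (4 * u) + u = 5 * u := by ring
  have c3 : (3 - 3) * (4 * u) + u = u := by ring
  have d0 : 13 * u - 4 * u = 9 * u := by ring
  have d1 : 9 * u - 4 * u = 5 * u := by ring
  have d2 : 5 * u - 4 * u = u := by ring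
  have d3 : u - 4 * u = -3 * u := by ring
  have d4 : -3 * u - 4 * u = -7 * u := by ring
  have d5 : -7 * u - 4 * u = -11 * u := by ring
  have hp : 0 ≤ u ∧ u < 4 * u := ⟨hu0.le, by linarith⟩
  have n0 : ¬(0 ≤ 13 * u ∧ 13 * u < 4 * u) := fun h => by linarith [h.2]
  have n1 : ¬(0 ≤ 9 * u ∧ 9 * u < 4 * u) := fun h => by linarith [h.2]
  have n2 : ¬(0 ≤ 5 * u ∧ 5 * u < 4 * u) := fun h => by linarith [h.2]
  have n3 : ¬(0 ≤ -3 * u ∧ -3 * u < 4 * u) := fun h => by linarith [h.1]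
  have n4 : ¬(0 ≤ -7 * u ∧ -7 * u < 4 * u) := fun h => by linarith [h.1]
  have n5 : ¬(0 ≤ -11 * u ∧ -11 * u < 4 * u) := fun h => by linarith [h.1]
  rw [c0, c1, c2, c3]
  simp only [d0, d1, d2, d3, d4, d5, if_pos hp, if_neg n0, if_neg n1, if_neg n2, if_neg n3,
    if_neg n4, if_neg n5]
  refine ⟨?_, ?_, ?_, ?_⟩ <;> push_cast <;> ring_nf

/-! Put u = α/2^(k+2), C = cos 2u, E = cos 6u. Up to a scalar, the level-k symbol is
(1+z)(1+2Cz+z²)(1+2Ez+z²)(1+bz+z²) (`fourPointMask_eq_masks`), and it tends to (1+z)⁵(1+22z+z²)/384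
with error O(2⁻ᵏ).

Cancelling 1+z gives a scheme for scaled first differences. Cancelling 1+2Cz+z² gives one for the
scaled second differences that annihilate cos αx and sin αx, and 1+2Ez+z² does the same at frequency
3α. This yields five schemes: for the data, its first differences, its oscillatory differences, the
first differences of these, and their oscillatory differences at frequency 3α. Each is a summable
perturbation of a stationary rule that contracts differences, so each converges uniformly to a
continuous function (`exists_regularLimit_of_refinement`); call the limits g, g₁, g₂, g₃, g₄.

Uniform limits of scaled differences are derivatives (`DyadicLimit.hasDerivAt`), and an oscillatory
difference differs from the ordinary second difference by a term tending to θ² times the function.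
Hence g' = g₁, g₁' = g₂ - α²g, g₂' = g₃, g₃' = g₄ - 9α²g₂, and a bootstrap gives g ∈ C⁴. Constant
data stay constant in the index and are multiplied at each level by a positive mask sum; the product
of these sums converges to a positive number, so the limit is nonzero. -/

/-! ### Limits of grid functions and their derivatives. -/

/-- The sequences `F k`, attached to the grids `2⁻ᵏ ℤ`, converge uniformly to `g`. -/
def DyadicLimit (F : ℕ → ℤ → ℝ) (g : ℝ → ℝ) : Prop :=
  ∀ ε : ℝ, 0 < ε → ∀ᶠ k : ℕ in atTop, ∀ i : ℤ, |F k i - g ((i : ℝ) / 2 ^ k)| ≤ ε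

/-- Summing the recursion over k < n bounds (1 - ρ) times the n-th partial sum by d 0 + ∑ η. -/
theorem summable_of_contraction {d η : ℕ → ℝ} {ρ : ℝ} (hρ : ρ < 1) (hd : ∀ k, 0 ≤ d k)
    (hη : ∀ k, 0 ≤ η k) (hs : Summable η) (h : ∀ k, d (k + 1) ≤ ρ * d k + η k) : Summable d := by
  have hρ' : 0 < 1 - ρ := by linarith
  refine summable_of_sum_range_le (c := (d 0 + ∑' k, η k) / (1 - ρ)) hd fun n => ?_
  rw [le_div_iff₀ hρ']
  have h1 : ∑ k ∈ Finset.range (n + 1), d k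
      ≤ ρ * ∑ k ∈ Finset.range n, d k + ∑ k ∈ Finset.range n, η k + d 0 := by
    rw [Finset.sum_range_succ', Finset.mul_sum, ← Finset.sum_add_distrib]
    gcongr with k _
    exact h k
  have h2 : ∑ k ∈ Finset.range n, η k ≤ ∑' k, η k := hs.sum_le_tsum _ fun k _ => hη k
  rw [Finset.sum_range_succ] at h1
  linarith [hd n]

/-- Values on consecutive grids which are uniformly close, with summable errors, and whose
differences are summably small have a continuous limit. -/
theorem exists_dyadicLimit {F : ℕ → ℤ → ℝ} {d δ : ℕ → ℝ} (hd : Summable d) (hδ : Summable δ)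
    (hF : ∀ k n, |F k (n + 1) - F k n| ≤ d k)
    (he : ∀ k n, |F (k + 1) (2 * n) - F k n| ≤ δ k)
    (ho : ∀ k n, |F (k + 1) (2 * n + 1) - F k n| ≤ δ k) :
    ∃ g, Continuous g ∧ DyadicLimit F g ∧ DyadicLimit (fun k n => F k (n + 1)) g := by
  -- The floor of 2^(k+1) x is 2m or 2m + 1 with m the floor of 2^k x, so one refinement step moves
  -- the value followed at x by at most δ k, uniformly in x.
  have hstep : ∀ x : ℝ, ∀ k, dist (F k ⌊2 ^ k * x⌋) (F (k + 1) ⌊2 ^ (k + 1) * x⌋) ≤ δ k := by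
    intro x k
    rw [dist_comm, Real.dist_eq]
    have h1 : (2 : ℝ) ^ (k + 1) * x = 2 * (2 ^ k * x) := by ring
    have h2 : ⌊(2 : ℝ) ^ (k + 1) * x⌋ = 2 * ⌊2 ^ k * x⌋ ∨
        ⌊(2 : ℝ) ^ (k + 1) * x⌋ = 2 * ⌊2 ^ k * x⌋ + 1 := by
      rw [h1]
      have a1 := Int.floor_le ((2 : ℝ) ^ k * x)
      have a2 := Int.lt_floor_add_one ((2 : ℝ) ^ k * x)
      have a3 : 2 * ⌊(2 : ℝ) ^ k * x⌋ ≤ ⌊2 * ((2 : ℝ) ^ k * x)⌋ := by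
        rw [Int.le_floor]; push_cast; linarith
      have a4 : ⌊2 * ((2 : ℝ) ^ k * x)⌋ < 2 * ⌊(2 : ℝ) ^ k * x⌋ + 2 := by
        rw [Int.floor_lt]; push_cast; linarith
      omega
    rcases h2 with h2 | h2 <;> rw [h2]
    · exact he k _
    · exact ho k _
  have hlim : ∀ x : ℝ, ∃ y, Tendsto (fun k => F k ⌊2 ^ k * x⌋) atTop (nhds y) := fun x =>
    cauchySeq_tendsto_of_complete (cauchySeq_of_dist_le_of_summable δ (hstep x) hδ)
  choose g hg using hlim
  have hdist : ∀ x k, |F k ⌊2 ^ k * x⌋ - g x| ≤ ∑' m, δ (k + m) := fun x k => by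
    rw [← Real.dist_eq]
    exact dist_le_tsum_of_dist_le_of_tendsto δ (hstep x) hδ (hg x) k
  have htail : Tendsto (fun k => ∑' m, δ (k + m)) atTop (nhds 0) := by
    simpa [add_comm] using tendsto_sum_nat_add δ
  have hlimit : DyadicLimit F g := fun ε hε => by
    filter_upwards [htail.eventually_lt_const hε] with k hk i
    have h := hdist ((i : ℝ) / 2 ^ k) k
    rw [mul_div_cancel₀ _ (by positivity), Int.floor_intCast] at h
    exact h.trans hk.le
  refine ⟨g, ?_, hlimit, fun ε hε => ?_⟩
  · rw [Metric.continuous_iff]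
    intro x ε hε
    obtain ⟨k, hk1, hk2⟩ := ((htail.eventually_lt_const (by linarith : 0 < ε / 3)).and
      (hd.tendsto_atTop_zero.eventually_lt_const (by linarith : 0 < ε / 3))).exists
    refine ⟨1 / 2 ^ k, by positivity, fun y hy => ?_⟩
    -- Points closer than one mesh width have equal or adjacent grid indices.
    have hclose : ∀ a b : ℝ, a ≤ b → b - a < 1 / 2 ^ k →
        |F k ⌊2 ^ k * b⌋ - F k ⌊2 ^ k * a⌋| ≤ d k := by
      intro a b hab hba
      have hp : (0 : ℝ) < 2 ^ k := by positivity
      have h1 : (2 : ℝ) ^ k * b < 2 ^ k * a + 1 := by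
        rw [lt_div_iff₀ hp] at hba; linarith
      have h2 : ⌊(2 : ℝ) ^ k * a⌋ ≤ ⌊(2 : ℝ) ^ k * b⌋ :=
        Int.floor_le_floor (by gcongr)
      have h3 : ⌊(2 : ℝ) ^ k * b⌋ ≤ ⌊(2 : ℝ) ^ k * a⌋ + 1 := by
        rw [← Int.floor_add_one]; exact Int.floor_le_floor h1.le
      rcases (by omega : ⌊(2 : ℝ) ^ k * b⌋ = ⌊(2 : ℝ) ^ k * a⌋ ∨
        ⌊(2 : ℝ) ^ k * b⌋ = ⌊(2 : ℝ) ^ k * a⌋ + 1) with h | h <;> rw [h]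
      · rw [sub_self, abs_zero]; exact (abs_nonneg _).trans (hF k 0)
      · exact hF k _
    have hxy : |F k ⌊2 ^ k * y⌋ - F k ⌊2 ^ k * x⌋| ≤ d k := by
      rw [Real.dist_eq, abs_lt] at hy
      rcases le_total x y with h | h
      · exact hclose x y h hy.2
      · rw [abs_sub_comm]; exact hclose y x h (by linarith [hy.1])
    have hx := abs_le.1 (hdist x k)
    have hy' := abs_le.1 (hdist y k)
    have hxy' := abs_le.1 hxy
    rw [Real.dist_eq, abs_lt]
    constructor <;> linarith [hx.1, hx.2, hy'.1, hy'.2, hxy'.1, hxy'.2]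
  · filter_upwards [hlimit (ε / 2) (by linarith),
      hd.tendsto_atTop_zero.eventually_lt_const (by linarith : 0 < ε / 2)] with k h1 h2 i
    have h3 := abs_le.1 (h1 i)
    have h4 := abs_le.1 (hF k i)
    rw [abs_le]
    constructor <;> linarith [h3.1, h3.2, h4.1, h4.2]

theorem tendsto_floor_div (x : ℝ) :
    Tendsto (fun k : ℕ => (⌊(2 : ℝ) ^ k * x⌋ : ℝ) / 2 ^ k) atTop (nhds x) := by
  have h0 : Tendsto (fun k : ℕ => (1 : ℝ) / 2 ^ k) atTop (nhds 0) := by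
    simpa using tendsto_pow_atTop_nhds_zero_of_lt_one (r := (1 / 2 : ℝ)) (by norm_num) (by norm_num)
  refine tendsto_of_tendsto_of_tendsto_of_le_of_le (g := fun k : ℕ => x - 1 / 2 ^ k)
    (by simpa using tendsto_const_nhds.sub h0) tendsto_const_nhds (fun k => ?_) (fun k => ?_)
  · have := (Int.sub_one_lt_floor ((2 : ℝ) ^ k * x)).le
    have hp : (0 : ℝ) < 2 ^ k := by positivity
    simp only
    rw [le_div_iff₀ hp, sub_mul, div_mul_cancel₀ _ hp.ne']
    linarith
  · have hp : (0 : ℝ) < 2 ^ k := by positivity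
    simp only
    rw [div_le_iff₀ hp]
    linarith [Int.floor_le ((2 : ℝ) ^ k * x)]

theorem DyadicLimit.tendsto {F : ℕ → ℤ → ℝ} {g : ℝ → ℝ} (h : DyadicLimit F g)
    (hg : Continuous g) (x : ℝ) : Tendsto (fun k => F k ⌊2 ^ k * x⌋) atTop (nhds (g x)) := by
  have h1 : Tendsto (fun k : ℕ => g ((⌊(2 : ℝ) ^ k * x⌋ : ℝ) / 2 ^ k)) atTop (nhds (g x)) :=
    (hg.tendsto x).comp (tendsto_floor_div x)
  have h2 : Tendsto (fun k : ℕ => F k ⌊2 ^ k * x⌋ - g ((⌊(2 : ℝ) ^ k * x⌋ : ℝ) / 2 ^ k))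
      atTop (nhds 0) := by
    rw [Metric.tendsto_nhds]
    intro ε hε
    filter_upwards [h (ε / 2) (by linarith)] with k hk
    rw [Real.dist_eq, sub_zero]
    linarith [hk ⌊2 ^ k * x⌋]
  simpa using h2.add h1

theorem DyadicLimit.unique {F : ℕ → ℤ → ℝ} {g g' : ℝ → ℝ} (h : DyadicLimit F g)
    (h' : DyadicLimit F g') (hg : Continuous g) (hg' : Continuous g') : g = g' :=
  funext fun x => tendsto_nhds_unique (h.tendsto hg x) (h'.tendsto hg' x)

/-- If the scaled differences of a sequence of grid functions stay near `c` between `x` and `y`,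
then the increment of the limit is near `c * (y - x)`. -/
theorem DyadicLimit.increment_le {F : ℕ → ℤ → ℝ} {g g₁ : ℝ → ℝ} (h : DyadicLimit F g)
    (h₁ : DyadicLimit (fun k n => 2 ^ k * (F k (n + 1) - F k n)) g₁) (hg : Continuous g)
    {x y c ε r : ℝ} (hxy : x ≤ y) (hr : 0 < r) (hc : ∀ t, x - r ≤ t → t ≤ y → |g₁ t - c| ≤ ε) :
    |g y - g x - c * (y - x)| ≤ ε * (y - x) := by
  have key : ∀ η > 0, |g y - g x - c * (y - x)| ≤ (ε + η) * (y - x) := by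
    intro η hη
    have hL := ((((h.tendsto hg y).sub (h.tendsto hg x)).sub
      (((tendsto_floor_div y).sub (tendsto_floor_div x)).const_mul c))).abs
    have hR := ((tendsto_floor_div y).sub (tendsto_floor_div x)).const_mul (ε + η)
    refine le_of_tendsto_of_tendsto hL hR ?_
    -- The grid point below x may lie to the left of x; the margin r absorbs this for large k.
    filter_upwards [h₁ η hη,
      (tendsto_floor_div x).eventually_const_le (by linarith : x - r < x)] with k hk hkx
    have hp : (0 : ℝ) < 2 ^ k := by positivity
    obtain ⟨m, hm⟩ := Int.eq_ofNat_of_zero_le (sub_nonneg.2 (Int.floor_le_floor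
      (by gcongr : (2 : ℝ) ^ k * x ≤ 2 ^ k * y)))
    have hm' : ⌊(2 : ℝ) ^ k * y⌋ = ⌊(2 : ℝ) ^ k * x⌋ + m := by omega
    have hy : ((⌊(2 : ℝ) ^ k * x⌋ + m : ℝ)) ≤ 2 ^ k * y := by
      have := Int.floor_le ((2 : ℝ) ^ k * y)
      rw [hm'] at this; push_cast at this; exact this
    rw [hm']
    set a := ⌊(2 : ℝ) ^ k * x⌋
    have hind : ∀ p : ℕ, p ≤ m →
        |2 ^ k * (F k (a + p) - F k a) - c * p| ≤ (ε + η) * p := by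
      intro p
      induction p with
      | zero => intro _; simp
      | succ p ih =>
        intro hpm
        have i1 := ih (by omega)
        have hpm' : (p : ℝ) + 1 ≤ m := by exact_mod_cast hpm
        have i2 := hk (a + p)
        have i3 := hc (((a + p : ℤ) : ℝ) / 2 ^ k)
          (hkx.trans (by push_cast; gcongr; linarith [(Nat.cast_nonneg p : (0 : ℝ) ≤ p)]))
          (by rw [div_le_iff₀ hp]; push_cast; linarith)
        rw [abs_le] at i1 i2 i3 ⊢
        rw [show a + ((p + 1 : ℕ) : ℤ) = a + p + 1 by push_cast; ring]
        push_cast at i1 i2 i3 ⊢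
        constructor <;> linarith [i1.1, i1.2, i2.1, i2.2, i3.1, i3.2]
    have hfin := hind m le_rfl
    push_cast
    have e1 : F k (a + m) - F k a - c * (((a : ℝ) + m) / 2 ^ k - (a : ℝ) / 2 ^ k)
        = (2 ^ k * (F k (a + m) - F k a) - c * m) / 2 ^ k := by
      field_simp; ring
    have e2 : (ε + η) * (((a : ℝ) + m) / 2 ^ k - (a : ℝ) / 2 ^ k) = (ε + η) * m / 2 ^ k := by
      field_simp; ring
    rw [e1, e2, abs_div, abs_of_pos hp]
    gcongr
  refine le_of_forall_pos_le_add fun δ hδ => ?_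
  -- The summand 1 covers the case x = y.
  have h2 := key (δ / (y - x + 1)) (by have : 0 < y - x + 1 := by linarith
                                       positivity)
  refine h2.trans ?_
  have h3 : 0 < y - x + 1 := by linarith
  rw [add_mul]
  gcongr
  rw [div_mul_eq_mul_div, div_le_iff₀ h3]
  nlinarith

/-- The limit of the scaled differences is the derivative of the limit. -/
theorem DyadicLimit.hasDerivAt {F : ℕ → ℤ → ℝ} {g g₁ : ℝ → ℝ} (h : DyadicLimit F g)
    (h₁ : DyadicLimit (fun k n => 2 ^ k * (F k (n + 1) - F k n)) g₁) (hg : Continuous g)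
    (hg₁ : Continuous g₁) (x : ℝ) : HasDerivAt g (g₁ x) x := by
  rw [hasDerivAt_iff_isLittleO, Asymptotics.isLittleO_iff]
  intro ε hε
  obtain ⟨r, hr, hc⟩ := Metric.continuous_iff.1 hg₁ x ε hε
  -- Radius r/2 leaves a further margin r/2 to the left of the lower endpoint, also when that
  -- endpoint is y.
  filter_upwards [Metric.ball_mem_nhds x (by linarith : 0 < r / 2)] with y hy
  rw [Metric.mem_ball, Real.dist_eq, abs_lt] at hy
  have hc' : ∀ t, x - r < t → t < x + r → |g₁ t - g₁ x| ≤ ε := fun t h1 h2 =>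
    (hc t (by rw [Real.dist_eq, abs_lt]; constructor <;> linarith)).le
  rw [Real.norm_eq_abs, Real.norm_eq_abs, smul_eq_mul]
  rcases le_total x y with hxy | hxy
  · have := h.increment_le h₁ hg hxy (by linarith : 0 < r / 2)
      (fun t h1 h2 => hc' t (by linarith) (by linarith))
    rw [abs_of_nonneg (sub_nonneg.2 hxy), mul_comm (y - x)]
    exact this
  · have := h.increment_le h₁ hg hxy (by linarith [hy.1] : 0 < r / 2)
      (fun t h1 h2 => hc' t (by linarith) (by linarith))
    rw [abs_of_nonpos (sub_nonpos.2 hxy)]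
    rw [← abs_neg]
    convert this using 2 <;> ring

/-! ### Convergence of summable perturbations of contractive rules. -/

/-- Differentiability gives φ(u) - φ(0) = O(u), and u decays geometrically. -/
theorem summable_abs_sub_of_differentiableAt {φ : ℝ → ℝ} (hφ : DifferentiableAt ℝ φ 0) (α : ℝ) :
    Summable fun k : ℕ => |φ (α / 2 ^ (k + 2)) - φ 0| := by
  have hu : ∀ k : ℕ, α / 2 ^ (k + 2) = α / 4 * (1 / 2) ^ k := fun k => by
    rw [pow_add, one_div_pow]; field_simp; norm_num
  have hs : Summable fun k : ℕ => α / 2 ^ (k + 2) := by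
    simp_rw [hu]
    exact (summable_geometric_of_lt_one (by norm_num) (by norm_num)).mul_left _
  refine summable_of_isBigO_nat hs.abs ?_
  have := (hφ.isBigO_sub.comp_tendsto hs.tendsto_atTop_zero)
  refine (this.abs_left.abs_right).congr (fun k => ?_) fun k => ?_ <;> simp

theorem abs_sum_mul_le {a f : Fin 4 → ℝ} {M : ℝ} (hf : ∀ j, |f j| ≤ M) :
    |∑ j, a j * f j| ≤ (∑ j, |a j|) * M := by
  rw [Finset.sum_mul]
  refine (Finset.abs_sum_le_sum_abs _ _).trans (Finset.sum_le_sum fun j _ => ?_)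
  rw [abs_mul]
  exact mul_le_mul_of_nonneg_left (hf j) (abs_nonneg _)

theorem abs_sum_mul_le_of_mask {a f : Fin 4 → ℝ} {M : ℝ} (ha : ∀ j, 0 ≤ a j) (ha1 : ∑ j, a j = 1)
    (hf : ∀ j, |f j| ≤ M) : |∑ j, a j * f j| ≤ M := by
  have := abs_sum_mul_le (a := a) hf
  simpa only [abs_of_nonneg (ha _), ha1, one_mul] using this

/-- The windows `f (n - 1), …, f (n + 2)` of bounded differences. -/
theorem abs_window_sub_le {f : ℤ → ℝ} {d : ℝ} (h : ∀ n, |f (n + 1) - f n| ≤ d) (n : ℤ) (j : Fin 4) :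
    |f (n + j - 1) - f n| ≤ 2 * d := by
  have h0 := abs_le.1 (h (n - 1))
  have h1 := abs_le.1 (h n)
  have h2 := abs_le.1 (h (n + 1))
  rw [sub_add_cancel] at h0
  rw [show n + 1 + 1 = n + 2 by ring] at h2
  rw [abs_le]
  obtain hj | hj | hj | hj : (j : ℕ) = 0 ∨ (j : ℕ) = 1 ∨ (j : ℕ) = 2 ∨ (j : ℕ) = 3 := by omega
  · rw [show n + ((j : ℕ) : ℤ) - 1 = n - 1 by omega]
    constructor <;> linarith [h0.1, h0.2]
  · rw [show n + ((j : ℕ) : ℤ) - 1 = n by omega]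
    constructor <;> linarith [h0.1, h0.2]
  · rw [show n + ((j : ℕ) : ℤ) - 1 = n + 1 by omega]
    constructor <;> linarith [h1.1, h1.2]
  · rw [show n + ((j : ℕ) : ℤ) - 1 = n + 2 by omega]
    constructor <;> linarith [h1.1, h1.2, h2.1, h2.2]

/-- `f⁺` arises from `f` by a binary 4-point rule with masks `a` (even points), `b` (odd points). -/
def IsRefinement (a b : Fin 4 → ℝ) (f f' : ℤ → ℝ) : Prop :=
  ∀ n : ℤ, f' (2 * n) = ∑ j : Fin 4, a j * f (n + j - 1) ∧
    f' (2 * n + 1) = ∑ j : Fin 4, b j * f (n + j - 1)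

/-- The rule with masks `a`, `b` reproduces constants, has nonnegative masks and contracts
differences by the factor `ρ`. -/
structure IsContractiveRule (a b : Fin 4 → ℝ) (ρ : ℝ) : Prop where
  nonneg_even : ∀ j, 0 ≤ a j
  nonneg_odd : ∀ j, 0 ≤ b j
  sum_even : ∑ j, a j = 1
  sum_odd : ∑ j, b j = 1
  contract : ∀ (f : ℤ → ℝ) (d : ℝ), (∀ n, |f (n + 1) - f n| ≤ d) → ∀ n : ℤ,
    |∑ j : Fin 4, b j * f (n + j - 1) - ∑ j : Fin 4, a j * f (n + j - 1)| ≤ ρ * d ∧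
    |∑ j : Fin 4, a j * f (n + 1 + j - 1) - ∑ j : Fin 4, b j * f (n + j - 1)| ≤ ρ * d

theorem abs_sum_sub_sum_le {a a₀ f : Fin 4 → ℝ} {M : ℝ} (hf : ∀ j, |f j| ≤ M) :
    |∑ j, a j * f j - ∑ j, a₀ j * f j| ≤ (∑ j, |a j - a₀ j|) * M := by
  rw [← Finset.sum_sub_distrib]
  simp_rw [← sub_mul]
  exact abs_sum_mul_le hf

/-- A bound for the differences at level `k` of a perturbed contractive scheme. -/
noncomputable def contractionBound (ρ d₀ : ℝ) (η : ℕ → ℝ) : ℕ → ℝ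
  | 0 => d₀
  | k + 1 => ρ * contractionBound ρ d₀ η k + η k

/-- The grid functions `F k` are uniformly bounded, they converge uniformly to the continuous
function `g`, and so do their shifts by one step. -/
structure RegularLimit (F : ℕ → ℤ → ℝ) (g : ℝ → ℝ) : Prop where
  continuous : Continuous g
  limit : DyadicLimit F g
  limit_shift : DyadicLimit (fun k n => F k (n + 1)) g
  bounded : ∃ M, ∀ k n, |F k n| ≤ M

/-- A binary scheme whose rules are summable perturbations of a contractive rule converges. -/
theorem exists_regularLimit_of_refinement {a b : ℕ → Fin 4 → ℝ} {a₀ b₀ : Fin 4 → ℝ} {ρ M₀ : ℝ}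
    {F : ℕ → ℤ → ℝ} (hρ : ρ < 1) (hab : IsContractiveRule a₀ b₀ ρ)
    (hF : ∀ k, IsRefinement (a k) (b k) (F k) (F (k + 1))) (h0 : ∀ n, |F 0 n| ≤ M₀)
    (ha : ∀ j, Summable fun k => |a k j - a₀ j|) (hb : ∀ j, Summable fun k => |b k j - b₀ j|) :
    ∃ g, RegularLimit F g := by
  set ε : ℕ → ℝ := fun k => ∑ j, |a k j - a₀ j| + ∑ j, |b k j - b₀ j| with hε
  have hεs : Summable ε := (summable_sum fun j _ => ha j).add (summable_sum fun j _ => hb j)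
  have hε0 : ∀ k, 0 ≤ ε k := fun k => by positivity
  have hεa : ∀ k, ∑ j, |a k j - a₀ j| ≤ ε k := fun k => le_add_of_nonneg_right (by positivity)
  have hεb : ∀ k, ∑ j, |b k j - b₀ j| ≤ ε k := fun k => le_add_of_nonneg_left (by positivity)
  have hM₀ : 0 ≤ M₀ := (abs_nonneg _).trans (h0 0)
  have pert_even : ∀ k M, (∀ n, |F k n| ≤ M) → ∀ n : ℤ,
      |F (k + 1) (2 * n) - ∑ j : Fin 4, a₀ j * F k (n + j - 1)| ≤ ε k * M := by
    intro k M hM n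
    rw [(hF k n).1]
    exact (abs_sum_sub_sum_le fun j => hM _).trans
      (mul_le_mul_of_nonneg_right (hεa k) ((abs_nonneg _).trans (hM 0)))
  have pert_odd : ∀ k M, (∀ n, |F k n| ≤ M) → ∀ n : ℤ,
      |F (k + 1) (2 * n + 1) - ∑ j : Fin 4, b₀ j * F k (n + j - 1)| ≤ ε k * M := by
    intro k M hM n
    rw [(hF k n).2]
    exact (abs_sum_sub_sum_le fun j => hM _).trans
      (mul_le_mul_of_nonneg_right (hεb k) ((abs_nonneg _).trans (hM 0)))
  -- The limit rule does not increase the sup norm, so each step costs a factor 1 + ε k ≤ exp (ε k),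
  -- and the product of these stays bounded.
  have hbound : ∀ k n, |F k n| ≤ M₀ * Real.exp (∑ i ∈ Finset.range k, ε i) := by
    intro k
    induction k with
    | zero => simpa using h0
    | succ k ih =>
      set M := M₀ * Real.exp (∑ i ∈ Finset.range k, ε i) with hM
      have hM0 : 0 ≤ M := by positivity
      have hstep : ε k * M + M ≤ M₀ * Real.exp (∑ i ∈ Finset.range (k + 1), ε i) := by
        have : M * (ε k + 1) ≤ M * Real.exp (ε k) :=
          mul_le_mul_of_nonneg_left (Real.add_one_le_exp (ε k)) hM0
        rw [Finset.sum_range_succ, Real.exp_add, ← mul_assoc M₀, ← hM]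
        linarith
      intro n
      rcases Int.even_or_odd' n with ⟨m, rfl | rfl⟩
      · have h1 := abs_le.1 (pert_even k M ih m)
        have h2 := abs_le.1 (abs_sum_mul_le_of_mask hab.nonneg_even hab.sum_even
          (f := fun j : Fin 4 => F k (m + j - 1)) fun j => ih _)
        rw [abs_le]
        constructor <;> linarith [h1.1, h1.2, h2.1, h2.2]
      · have h1 := abs_le.1 (pert_odd k M ih m)
        have h2 := abs_le.1 (abs_sum_mul_le_of_mask hab.nonneg_odd hab.sum_odd
          (f := fun j : Fin 4 => F k (m + j - 1)) fun j => ih _)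
        rw [abs_le]
        constructor <;> linarith [h1.1, h1.2, h2.1, h2.2]
  obtain ⟨M, hM⟩ : ∃ M, ∀ k n, |F k n| ≤ M := by
    refine ⟨M₀ * Real.exp (∑' i, ε i), fun k n => (hbound k n).trans ?_⟩
    gcongr
    exact hεs.sum_le_tsum _ fun i _ => hε0 i
  have hM0 : 0 ≤ M := (abs_nonneg _).trans (hM 0 0)
  -- A difference involves two perturbed values, each off by at most ε k * M.
  set η : ℕ → ℝ := fun k => 2 * (ε k * M) with hη
  have hη0 : ∀ k, 0 ≤ η k := fun k => mul_nonneg two_pos.le (mul_nonneg (hε0 k) hM0)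
  have hηs : Summable η := (hεs.mul_right M).mul_left 2
  set d := contractionBound ρ (2 * M) η with hdef
  have hdF : ∀ k n, |F k (n + 1) - F k n| ≤ d k := by
    intro k
    induction k with
    | zero =>
      intro n
      have h1 := abs_le.1 (hM 0 n)
      have h2 := abs_le.1 (hM 0 (n + 1))
      rw [show d 0 = 2 * M from rfl, abs_le]
      constructor <;> linarith [h1.1, h1.2, h2.1, h2.2]
    | succ k ih =>
      intro n
      rw [show d (k + 1) = ρ * d k + 2 * (ε k * M) from rfl, abs_le]
      rcases Int.even_or_odd' n with ⟨m, rfl | rfl⟩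
      · have h1 := abs_le.1 (pert_even k M (hM k) m)
        have h2 := abs_le.1 (pert_odd k M (hM k) m)
        have h3 := abs_le.1 (hab.contract (F k) (d k) ih m).1
        constructor <;> linarith [h1.1, h1.2, h2.1, h2.2, h3.1, h3.2]
      · have h1 := abs_le.1 (pert_even k M (hM k) (m + 1))
        have h2 := abs_le.1 (pert_odd k M (hM k) m)
        have h3 := abs_le.1 (hab.contract (F k) (d k) ih m).2
        rw [show 2 * m + 1 + 1 = 2 * (m + 1) by ring]
        constructor <;> linarith [h1.1, h1.2, h2.1, h2.2, h3.1, h3.2]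
  have hds : Summable d := summable_of_contraction hρ
    (fun k => (abs_nonneg _).trans (hdF k 0)) hη0 hηs fun k => le_rfl
  have hdev : ∀ c : Fin 4 → ℝ, (∀ j, 0 ≤ c j) → ∑ j, c j = 1 → ∀ k n,
      |∑ j : Fin 4, c j * F k (n + j - 1) - F k n| ≤ 2 * d k := by
    intro c hc hc1 k n
    have h := abs_sum_mul_le_of_mask hc hc1
      (f := fun j : Fin 4 => F k (n + j - 1) - F k n) (abs_window_sub_le (hdF k) n)
    simpa only [mul_sub, Finset.sum_sub_distrib, ← Finset.sum_mul, hc1, one_mul] using h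
  have heven : ∀ k n, |F (k + 1) (2 * n) - F k n| ≤ 2 * d k + ε k * M := fun k n => by
    have h1 := abs_le.1 (pert_even k M (hM k) n)
    have h2 := abs_le.1 (hdev a₀ hab.nonneg_even hab.sum_even k n)
    rw [abs_le]
    constructor <;> linarith [h1.1, h1.2, h2.1, h2.2]
  have hodd : ∀ k n, |F (k + 1) (2 * n + 1) - F k n| ≤ 2 * d k + ε k * M := fun k n => by
    have h1 := abs_le.1 (pert_odd k M (hM k) n)
    have h2 := abs_le.1 (hdev b₀ hab.nonneg_odd hab.sum_odd k n)
    rw [abs_le]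
    constructor <;> linarith [h1.1, h1.2, h2.1, h2.2]
  obtain ⟨g, hg, hl, hs⟩ :=
    exists_dyadicLimit hds ((hds.mul_left 2).add (hεs.mul_right M)) hdF heven hodd
  exact ⟨g, hg, hl, hs, M, hM⟩

/-! ### Masks of the five schemes and their limits at mesh size zero. -/

/-- The mask value `a₃` as a function of the quarter mesh size `u = h / 4`. -/
noncomputable def maskScale (u : ℝ) : ℝ :=
  1 / ((4 * Real.cos u * Real.cos (2 * u)) ^ 3 * (2 * (2 * Real.cos (2 * u) ^ 2 - 1))
    * (4 * (2 * Real.cos (2 * u) ^ 2 - 1) ^ 2 - 1))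

/-- `cos (6 u)` in terms of `C = cos (2 u)`. -/
noncomputable def cosTriple (u : ℝ) : ℝ :=
  4 * Real.cos (2 * u) ^ 3 - 3 * Real.cos (2 * u)

/-- The middle coefficient of the factor `1 + b z + z²` of the symbol. -/
noncomputable def residualCoeff (u : ℝ) : ℝ :=
  12 * Real.cos (2 * u) ^ 2 + 10 * Real.cos (2 * u)

/-! The even and odd coefficients of the symbol `(1 + z) (1 + 2Cz + z²) (1 + 2Ez + z²) (1 + bz + z²)`
and of its quotients by `1 + z`, by `1 + 2Cz + z²`, and so on, up to scaling. -/

/-- Coefficients up to the middle one of the palindromic (1+2Ez+z²)(1+bz+z²). -/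
noncomputable def polyT (E b : ℝ) : Fin 3 → ℝ := ![1, b + 2 * E, 2 + 2 * E * b]

/-- Coefficients up to the middle one of the palindromic (1+2Cz+z²)(1+2Ez+z²)(1+bz+z²). In the masks
below, odd-indexed coefficients of a symbol act at even points and even-indexed ones at odd points.
-/
noncomputable def polyQ (C E b : ℝ) : Fin 4 → ℝ :=
  ![1, b + 2 * E + 2 * C, 2 + 2 * E * b + 2 * C * (b + 2 * E) + 1,
    2 * (b + 2 * E) + 2 * C * (2 + 2 * E * b)]

noncomputable def evenMask₀ (u : ℝ) : Fin 4 → ℝ := fun j =>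
  let q := polyQ (Real.cos (2 * u)) (cosTriple u) (residualCoeff u)
  maskScale u * ![q 1 + q 0, q 3 + q 2, q 2 + q 1, q 0] j

noncomputable def oddMask₀ (u : ℝ) : Fin 4 → ℝ := fun j =>
  let q := polyQ (Real.cos (2 * u)) (cosTriple u) (residualCoeff u)
  maskScale u * ![q 0, q 2 + q 1, q 3 + q 2, q 1 + q 0] j

noncomputable def evenMask₁ (u : ℝ) : Fin 4 → ℝ := fun j =>
  let q := polyQ (Real.cos (2 * u)) (cosTriple u) (residualCoeff u)
  2 * maskScale u * ![q 1, q 3, q 1, 0] j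

noncomputable def oddMask₁ (u : ℝ) : Fin 4 → ℝ := fun j =>
  let q := polyQ (Real.cos (2 * u)) (cosTriple u) (residualCoeff u)
  2 * maskScale u * ![q 0, q 2, q 2, q 0] j

noncomputable def evenMask₂ (u : ℝ) : Fin 4 → ℝ := fun j =>
  let t := polyT (cosTriple u) (residualCoeff u)
  4 * maskScale u * ![t 1 + t 0, t 2 + t 1, t 0, 0] j

noncomputable def oddMask₂ (u : ℝ) : Fin 4 → ℝ := fun j =>
  let t := polyT (cosTriple u) (residualCoeff u)
  4 * maskScale u * ![t 0, t 2 + t 1, t 1 + t 0, 0] j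

noncomputable def evenMask₃ (u : ℝ) : Fin 4 → ℝ := fun j =>
  let t := polyT (cosTriple u) (residualCoeff u)
  8 * maskScale u * ![t 1, t 1, 0, 0] j

noncomputable def oddMask₃ (u : ℝ) : Fin 4 → ℝ := fun j =>
  let t := polyT (cosTriple u) (residualCoeff u)
  8 * maskScale u * ![t 0, t 2, t 0, 0] j

noncomputable def evenMask₄ (u : ℝ) : Fin 4 → ℝ := fun j =>
  16 * maskScale u * ![1 + residualCoeff u, 1, 0, 0] j

noncomputable def oddMask₄ (u : ℝ) : Fin 4 → ℝ := fun j =>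
  16 * maskScale u * ![1, 1 + residualCoeff u, 0, 0] j

theorem maskScale_zero : maskScale 0 = 1 / 384 := by norm_num [maskScale]
theorem cosTriple_zero : cosTriple 0 = 1 := by norm_num [cosTriple]
theorem residualCoeff_zero : residualCoeff 0 = 22 := by norm_num [residualCoeff]

theorem differentiableAt_maskScale : DifferentiableAt ℝ maskScale 0 := by
  unfold maskScale
  refine DifferentiableAt.div (by fun_prop) (by fun_prop) ?_
  norm_num

theorem differentiableAt_cosTriple : DifferentiableAt ℝ cosTriple 0 := by
  unfold cosTriple; fun_prop

theorem differentiableAt_residualCoeff : DifferentiableAt ℝ residualCoeff 0 := by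
  unfold residualCoeff; fun_prop

theorem differentiableAt_mask {m : ℝ → Fin 4 → ℝ}
    (hm : m ∈ ({evenMask₀, oddMask₀, evenMask₁, oddMask₁, evenMask₂, oddMask₂, evenMask₃, oddMask₃,
      evenMask₄, oddMask₄} : Set (ℝ → Fin 4 → ℝ))) (j : Fin 4) :
    DifferentiableAt ℝ (fun u => m u j) 0 := by
  have h1 := differentiableAt_maskScale
  have h2 := differentiableAt_cosTriple
  have h3 := differentiableAt_residualCoeff
  simp only [Set.mem_insert_iff, Set.mem_singleton_iff] at hm
  rcases hm with rfl | rfl | rfl | rfl | rfl | rfl | rfl | rfl | rfl | rfl <;> fin_cases j <;>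
  simp [evenMask₀, oddMask₀, evenMask₁, oddMask₁, evenMask₂, oddMask₂, evenMask₃, oddMask₃,
      evenMask₄, oddMask₄, polyQ, polyT] <;> fun_prop

theorem sum_window (a : Fin 4 → ℝ) (f : ℤ → ℝ) (n : ℤ) :
    ∑ j : Fin 4, a j * f (n + j - 1)
      = a 0 * f (n - 1) + a 1 * f n + a 2 * f (n + 1) + a 3 * f (n + 2) := by
  rw [Fin.sum_univ_four]
  congr 1 <;> [congr 1; skip] <;> [congr 1; skip; skip] <;> congr 2 <;>
    simp <;> ring

/-- Summation by parts: as both masks have sum 1, differences of new values are combinations of old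
differences, whose coefficients are partial sums. The two hypotheses bound their ℓ¹ norms. -/
theorem isContractiveRule_of_coeffs {a b : Fin 4 → ℝ} {ρ : ℝ} (ha : ∀ j, 0 ≤ a j)
    (hb : ∀ j, 0 ≤ b j) (ha1 : a 0 + a 1 + a 2 + a 3 = 1) (hb1 : b 0 + b 1 + b 2 + b 3 = 1)
    (h : |a 0 - b 0| + |a 0 + a 1 - b 0 - b 1| + |b 3 - a 3| ≤ ρ)
    (h' : |b 0| + |b 0 + b 1 - a 0| + |a 2 + a 3 - b 3| + |a 3| ≤ ρ) :
    IsContractiveRule a b ρ := by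
  refine ⟨ha, hb, by rw [Fin.sum_univ_four, ha1], by rw [Fin.sum_univ_four, hb1], fun f d hf n => ?_⟩
  rw [sum_window, sum_window, sum_window]
  have hd : 0 ≤ d := (abs_nonneg _).trans (hf 0)
  have h0 := hf (n - 1)
  have h1 := hf n
  have h2 := hf (n + 1)
  have h3 := hf (n + 2)
  rw [sub_add_cancel] at h0
  rw [show n + 1 + 1 = n + 2 by ring] at h2 ⊢
  rw [show n + 2 + 1 = n + 3 by ring] at h3
  rw [show n + 1 - 1 = n by ring, show n + 1 + 2 = n + 3 by ring]
  have m : ∀ x y : ℝ, |y| ≤ d → |x * y| ≤ |x| * d := fun x y hy => by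
    rw [abs_mul]; exact mul_le_mul_of_nonneg_left hy (abs_nonneg _)
  constructor
  · refine le_trans ?_ (mul_le_mul_of_nonneg_right h hd)
    have e : b 0 * f (n - 1) + b 1 * f n + b 2 * f (n + 1) + b 3 * f (n + 2)
        - (a 0 * f (n - 1) + a 1 * f n + a 2 * f (n + 1) + a 3 * f (n + 2))
        = (a 0 - b 0) * (f n - f (n - 1)) + (a 0 + a 1 - b 0 - b 1) * (f (n + 1) - f n)
          + (b 3 - a 3) * (f (n + 2) - f (n + 1)) := by
      linear_combination f (n + 1) * (hb1 - ha1)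
    rw [e, add_mul, add_mul]
    exact (abs_add_three _ _ _).trans (by gcongr <;> exact m _ _ ‹_›)
  · refine le_trans ?_ (mul_le_mul_of_nonneg_right h' hd)
    have e : a 0 * f n + a 1 * f (n + 1) + a 2 * f (n + 2) + a 3 * f (n + 3)
        - (b 0 * f (n - 1) + b 1 * f n + b 2 * f (n + 1) + b 3 * f (n + 2))
        = b 0 * (f n - f (n - 1)) + (b 0 + b 1 - a 0) * (f (n + 1) - f n)
          + (a 2 + a 3 - b 3) * (f (n + 2) - f (n + 1)) + a 3 * (f (n + 3) - f (n + 2)) := by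
      linear_combination f (n + 1) * (ha1 - hb1)
    rw [e, add_mul, add_mul, add_mul]
    exact (abs_add_le _ _).trans (add_le_add ((abs_add_three _ _ _).trans
      (by gcongr <;> exact m _ _ ‹_›)) (m _ _ ‹_›))

theorem isContractiveRule_masks₀ : IsContractiveRule (evenMask₀ 0) (oddMask₀ 0) (11 / 12) := by
  apply isContractiveRule_of_coeffs <;> (try intro j; fin_cases j) <;>
    simp [evenMask₀, oddMask₀, polyQ, maskScale_zero, cosTriple_zero, residualCoeff_zero] <;>
    norm_num [abs_of_pos, abs_of_neg]

theorem isContractiveRule_masks₁ : IsContractiveRule (evenMask₁ 0) (oddMask₁ 0) (11 / 12) := by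
  apply isContractiveRule_of_coeffs <;> (try intro j; fin_cases j) <;>
    simp [evenMask₁, oddMask₁, polyQ, maskScale_zero, cosTriple_zero, residualCoeff_zero] <;>
    norm_num [abs_of_pos, abs_of_neg]

theorem isContractiveRule_masks₂ : IsContractiveRule (evenMask₂ 0) (oddMask₂ 0) (11 / 12) := by
  apply isContractiveRule_of_coeffs <;> (try intro j; fin_cases j) <;>
    simp [evenMask₂, oddMask₂, polyT, maskScale_zero, cosTriple_zero, residualCoeff_zero] <;>
    norm_num [abs_of_pos, abs_of_neg]

theorem isContractiveRule_masks₃ : IsContractiveRule (evenMask₃ 0) (oddMask₃ 0) (11 / 12) := by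
  apply isContractiveRule_of_coeffs <;> (try intro j; fin_cases j) <;>
    simp [evenMask₃, oddMask₃, polyT, maskScale_zero, cosTriple_zero, residualCoeff_zero] <;>
    norm_num [abs_of_pos, abs_of_neg]

/-- The limit masks are (23, 1)/24 and (1, 23)/24, so the factor 22/24 = 11/12 is attained here; it
serves for all five rules. -/
theorem isContractiveRule_masks₄ : IsContractiveRule (evenMask₄ 0) (oddMask₄ 0) (11 / 12) := by
  apply isContractiveRule_of_coeffs <;> (try intro j; fin_cases j) <;>
    simp [evenMask₄, oddMask₄, maskScale_zero, residualCoeff_zero] <;>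
    norm_num [abs_of_pos, abs_of_neg]

/-! ### Factorization of the trigonometric mask. -/

/-- The quarter mesh size at level `k`. -/
noncomputable def quarterMesh (α : ℝ) (k : ℕ) : ℝ := α / 2 ^ (k + 2)

theorem quarterMesh_pos {α : ℝ} (hα : 0 < α) (k : ℕ) : 0 < quarterMesh α k := by
  unfold quarterMesh; positivity

theorem four_mul_quarterMesh (α : ℝ) (k : ℕ) : α / 2 ^ k = 4 * quarterMesh α k := by
  rw [quarterMesh, pow_add]; field_simp; norm_num

theorem four_mul_quarterMesh_lt {α : ℝ} (hα : α ∈ Set.Ioo 0 (Real.pi / 3)) (k : ℕ) :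
    4 * quarterMesh α k < Real.pi / 3 := by
  rw [← four_mul_quarterMesh]
  exact (div_le_self hα.1.le (one_le_pow₀ one_le_two)).trans_lt hα.2

theorem cos_four_mul (u : ℝ) : Real.cos (4 * u) = 2 * Real.cos (2 * u) ^ 2 - 1 := by
  rw [← Real.cos_two_mul]; ring_nf

theorem sin_odd_mul (u : ℝ) (n : ℕ) :
    Real.sin ((n + 4 : ℕ) * u) = 2 * Real.cos (2 * u) * Real.sin ((n + 2 : ℕ) * u)
      - Real.sin (n * u) := by
  have h1 : ((n + 4 : ℕ) : ℝ) * u = (n + 2 : ℕ) * u + 2 * u := by push_cast; ring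
  have h2 : (n : ℝ) * u = (n + 2 : ℕ) * u - 2 * u := by push_cast; ring
  rw [h1, h2, Real.sin_add, Real.sin_sub]; ring

theorem sin_three_mul' (u : ℝ) :
    Real.sin ((3 : ℕ) * u) = Real.sin u * (2 * Real.cos (2 * u) + 1) := by
  rw [Nat.cast_ofNat, Real.sin_three_mul, Real.cos_two_mul]
  linear_combination (-4 * Real.sin u) * Real.sin_sq_add_cos_sq u

/-- Sines of odd multiples of u are sin u times polynomials in C = cos 2u, and the denominator also
contains sin³ u; after cancellation each coefficient is an identity of polynomials in C. -/
theorem fourPointMask_eq_masks {α : ℝ} (hα : α ∈ Set.Ioo 0 (Real.pi / 3)) (k : ℕ) (j : Fin 4) :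
    fourPointMask α k j = evenMask₀ (quarterMesh α k) j := by
  set u := quarterMesh α k with hu
  have hu0 : 0 < u := quarterMesh_pos hα.1 k
  have hu1 : 4 * u < Real.pi / 3 := four_mul_quarterMesh_lt hα k
  have hs1 : Real.sin u ≠ 0 := (Real.sin_pos_of_pos_of_lt_pi hu0 (by linarith [Real.pi_pos])).ne'
  have hk := four_mul_quarterMesh α k
  rw [← hu] at hk
  obtain ⟨h0, h1, h2, h3⟩ := fourPointMask_eq hα.1 k (s := fun n => Real.sin (n * u))
    (fun n => by rw [mul_div_assoc, hu, quarterMesh]) rfl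
  have e3 := sin_three_mul' u
  have e5 := sin_odd_mul u 1
  have e7 := sin_odd_mul u 3
  have e9 := sin_odd_mul u 5
  have e11 := sin_odd_mul u 7
  norm_num only [Nat.cast_one, one_mul] at e5
  norm_num only at e3 e7 e9 e11
  set C := Real.cos (2 * u) with hC
  have hD : Real.sin (α / 2 ^ k) * Real.sin (2 * α / 2 ^ k) * Real.sin (3 * α / 2 ^ k)
      = Real.sin u ^ 3 * ((4 * Real.cos u * C) ^ 3 * (2 * (2 * C ^ 2 - 1))
        * (4 * (2 * C ^ 2 - 1) ^ 2 - 1)) := by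
    rw [mul_div_assoc, mul_div_assoc, hk, Real.sin_two_mul (4 * u), Real.sin_three_mul (4 * u),
      ← cos_four_mul]
    have h4 : Real.sin (4 * u) = 4 * Real.sin u * Real.cos u * C := by
      rw [show 4 * u = 2 * (2 * u) by ring, Real.sin_two_mul, Real.sin_two_mul]; ring
    have h5 : Real.sin (4 * u) ^ 2 = 1 - Real.cos (4 * u) ^ 2 := Real.sin_sq _
    have h6 : 3 * Real.sin (4 * u) - 4 * Real.sin (4 * u) ^ 3
        = Real.sin (4 * u) * (4 * Real.cos (4 * u) ^ 2 - 1) := by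
      linear_combination (-4 * Real.sin (4 * u)) * h5
    rw [h6, h4]; ring
  have hscale : ∀ x, Real.sin u ^ 3 * x / (Real.sin (α / 2 ^ k) * Real.sin (2 * α / 2 ^ k)
      * Real.sin (3 * α / 2 ^ k)) = maskScale u * x := fun x => by
    rw [hD, mul_div_mul_left _ _ (pow_ne_zero 3 hs1), maskScale]; ring
  simp only [Nat.cast_ofNat, Nat.cast_one, one_mul] at h0 h1 h2 h3 e3
  rw [e3] at e5 e7 h0 h1 h2
  rw [e5] at e7 e9 h1 h2
  rw [e7] at e9 e11 h1 h2
  rw [e9] at e11 h1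
  rw [e11] at h2
  fin_cases j
  · refine h0.trans (Eq.trans ?_ ((hscale _).trans rfl))
    congr 1
    simp [polyQ, cosTriple, residualCoeff, ← hC]; ring
  · refine h1.trans (Eq.trans ?_ ((hscale _).trans rfl))
    congr 1
    simp [polyQ, cosTriple, residualCoeff, ← hC]; ring
  · refine h2.trans (Eq.trans ?_ ((hscale _).trans rfl))
    congr 1
    simp [polyQ, cosTriple, residualCoeff, ← hC]; ring
  · refine h3.trans (Eq.trans ?_ ((hscale _).trans rfl))
    congr 1
    simp [polyQ]

theorem isRefinement_masks₀ {α : ℝ} (hα : α ∈ Set.Ioo 0 (Real.pi / 3)) (f : ℤ → ℝ) (k : ℕ) :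
    IsRefinement (evenMask₀ (quarterMesh α k)) (oddMask₀ (quarterMesh α k))
      f (fourPointScheme α k f) := by
  have hodd : ∀ j : Fin 4, oddMask₀ (quarterMesh α k) j = fourPointMask α k (Fin.rev j) := by
    intro j
    rw [fourPointMask_eq_masks hα]
    fin_cases j <;> simp [oddMask₀, evenMask₀, Fin.rev]
  intro n
  rw [sum_window, sum_window, hodd, hodd, hodd, hodd]
  simp only [← fourPointMask_eq_masks hα]
  constructor
  · rw [fourPointScheme, fourPointRefine, if_pos (even_two_mul n)]
    rw [show 2 * n / 2 = n by omega]
  · rw [fourPointScheme, fourPointRefine, if_neg (by simp)]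
    rw [show (2 * n + 1) / 2 = n by omega]
    rfl

/-! ### Schemes for ordinary and oscillatory differences. -/

/-- Differences divided by the mesh size `2⁻ᵏ`. -/
def scaledDiff (F : ℕ → ℤ → ℝ) (k : ℕ) (n : ℤ) : ℝ := 2 ^ k * (F k (n + 1) - F k n)

/-- Scaled second differences which annihilate `cos (θ x)` and `sin (θ x)` on the grid `2⁻ᵏ ℤ`. -/
noncomputable def scaledOscDiff (θ : ℝ) (F : ℕ → ℤ → ℝ) (k : ℕ) (n : ℤ) : ℝ :=
  4 ^ k * (F k (n + 2) - 2 * Real.cos (θ / 2 ^ k) * F k (n + 1) + F k n)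

theorem IsRefinement.expand {a b : Fin 4 → ℝ} {f f' : ℤ → ℝ} (h : IsRefinement a b f f') (n : ℤ) :
    f' (2 * n) = a 0 * f (n - 1) + a 1 * f n + a 2 * f (n + 1) + a 3 * f (n + 2) ∧
    f' (2 * n + 1) = b 0 * f (n - 1) + b 1 * f n + b 2 * f (n + 1) + b 3 * f (n + 2) ∧
    f' (2 * n + 2) = a 0 * f n + a 1 * f (n + 1) + a 2 * f (n + 2) + a 3 * f (n + 3) ∧
    f' (2 * n + 3) = b 0 * f n + b 1 * f (n + 1) + b 2 * f (n + 2) + b 3 * f (n + 3) := by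
  have h1 := h n
  have h2 := h (n + 1)
  rw [sum_window, sum_window] at h1 h2
  rw [show n + 1 + 1 = n + 2 by ring, show n + 1 - 1 = n by ring, show n + 1 + 2 = n + 3 by ring,
    show 2 * (n + 1) + 1 = 2 * n + 3 by ring, show 2 * (n + 1) = 2 * n + 2 by ring] at h2
  exact ⟨h1.1, h1.2, h2.1, h2.2⟩

/-- The mask hypotheses say that the symbol of `a`, `b` is (1+z)/2 times that of `a'`, `b'`; the
rule then follows from (1+z)(1-z) = 1-z². -/
theorem IsRefinement.scaledDiff {a b a' b' : Fin 4 → ℝ} {F : ℕ → ℤ → ℝ} {k : ℕ}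
    (h : IsRefinement a b (F k) (F (k + 1))) (h3 : a' 3 = 0)
    (ha : a = ![(b' 0 + a' 0) / 2, (b' 1 + a' 1) / 2, (b' 2 + a' 2) / 2, b' 3 / 2])
    (hb : b = ![b' 0 / 2, (a' 0 + b' 1) / 2, (a' 1 + b' 2) / 2, (a' 2 + b' 3) / 2]) :
    IsRefinement a' b' (scaledDiff F k) (scaledDiff F (k + 1)) := by
  intro n
  obtain ⟨e0, e1, e2, -⟩ := h.expand n
  rw [sum_window, sum_window, h3]
  simp only [_root_.scaledDiff, sub_add_cancel]
  rw [show n + 1 + 1 = n + 2 by ring, show n + 2 + 1 = n + 3 by ring,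
    show 2 * n + 1 + 1 = 2 * n + 2 by ring, e0, e1, e2, ha, hb, pow_succ]
  simp only [Matrix.cons_val]
  constructor <;> ring

theorem cos_div_pow (θ : ℝ) (k : ℕ) :
    Real.cos (θ / 2 ^ k) = 2 * Real.cos (θ / 2 ^ (k + 1)) ^ 2 - 1 := by
  rw [← Real.cos_two_mul, pow_succ]; congr 1; field_simp

/-- Here the cancelled factor is (1+2cz+z²)/4, and (1+2cz+z²)(1-2cz+z²) = 1-2(2c²-1)z²+z⁴, where
2c²-1 is the cosine at the coarser level. -/
theorem IsRefinement.scaledOscDiff {θ c : ℝ} {a b a' b' : Fin 4 → ℝ} {F : ℕ → ℤ → ℝ} {k : ℕ}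
    (h : IsRefinement a b (F k) (F (k + 1))) (hc : Real.cos (θ / 2 ^ (k + 1)) = c)
    (h3 : a' 3 = 0) (h3' : b' 3 = 0)
    (ha : a = ![(a' 0 + 2 * c * b' 0) / 4, (a' 1 + 2 * c * b' 1 + a' 0) / 4,
      (a' 2 + 2 * c * b' 2 + a' 1) / 4, a' 2 / 4])
    (hb : b = ![b' 0 / 4, (b' 1 + 2 * c * a' 0 + b' 0) / 4, (b' 2 + 2 * c * a' 1 + b' 1) / 4,
      (2 * c * a' 2 + b' 2) / 4]) :
    IsRefinement a' b' (scaledOscDiff θ F k) (scaledOscDiff θ F (k + 1)) := by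
  intro n
  obtain ⟨e0, e1, e2, e3⟩ := h.expand n
  rw [sum_window, sum_window, h3, h3']
  simp only [_root_.scaledOscDiff, sub_add_cancel]
  rw [show n - 1 + 2 = n + 1 by ring, show n + 1 + 1 = n + 2 by ring,
    show n + 1 + 2 = n + 3 by ring, show 2 * n + 1 + 1 = 2 * n + 2 by ring,
    show 2 * n + 1 + 2 = 2 * n + 3 by ring, e0, e1, e2, e3, ha, hb, pow_succ, cos_div_pow θ k, hc]
  simp only [Matrix.cons_val]
  constructor <;> ring

section Scheme

variable {α : ℝ} {F : ℕ → ℤ → ℝ}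

theorem cos_quarterMesh (α : ℝ) (k : ℕ) :
    Real.cos (α / 2 ^ (k + 1)) = Real.cos (2 * quarterMesh α k) := by
  rw [quarterMesh, pow_succ _ (k + 1)]; congr 1; field_simp

theorem cos_three_quarterMesh (α : ℝ) (k : ℕ) :
    Real.cos (3 * α / 2 ^ (k + 1)) = cosTriple (quarterMesh α k) := by
  rw [cosTriple, ← Real.cos_three_mul, quarterMesh, pow_succ _ (k + 1)]; congr 1; field_simp

theorem isRefinement_masks₁ {k : ℕ}
    (h : IsRefinement (evenMask₀ (quarterMesh α k)) (oddMask₀ (quarterMesh α k)) (F k) (F (k + 1))) :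
    IsRefinement (evenMask₁ (quarterMesh α k)) (oddMask₁ (quarterMesh α k))
      (scaledDiff F k) (scaledDiff F (k + 1)) := by
  refine h.scaledDiff (by simp [evenMask₁]) ?_ ?_ <;> ext j <;> fin_cases j <;>
    simp [evenMask₀, evenMask₁, oddMask₀, oddMask₁] <;> ring

theorem isRefinement_masks₂ {k : ℕ}
    (h : IsRefinement (evenMask₀ (quarterMesh α k)) (oddMask₀ (quarterMesh α k)) (F k) (F (k + 1))) :
    IsRefinement (evenMask₂ (quarterMesh α k)) (oddMask₂ (quarterMesh α k))
      (scaledOscDiff α F k) (scaledOscDiff α F (k + 1)) := by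
  refine h.scaledOscDiff (cos_quarterMesh α k) (by simp [evenMask₂]) (by simp [oddMask₂]) ?_ ?_ <;>
    ext j <;> fin_cases j <;>
    simp [evenMask₀, evenMask₂, oddMask₀, oddMask₂, polyQ, polyT] <;> ring

theorem isRefinement_masks₃ {k : ℕ}
    (h : IsRefinement (evenMask₂ (quarterMesh α k)) (oddMask₂ (quarterMesh α k)) (F k) (F (k + 1))) :
    IsRefinement (evenMask₃ (quarterMesh α k)) (oddMask₃ (quarterMesh α k))
      (scaledDiff F k) (scaledDiff F (k + 1)) := by
  refine h.scaledDiff (by simp [evenMask₃]) ?_ ?_ <;> ext j <;> fin_cases j <;>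
    simp [evenMask₂, evenMask₃, oddMask₂, oddMask₃] <;> ring

theorem isRefinement_masks₄ {k : ℕ}
    (h : IsRefinement (evenMask₂ (quarterMesh α k)) (oddMask₂ (quarterMesh α k)) (F k) (F (k + 1))) :
    IsRefinement (evenMask₄ (quarterMesh α k)) (oddMask₄ (quarterMesh α k))
      (scaledOscDiff (3 * α) F k) (scaledOscDiff (3 * α) F (k + 1)) := by
  refine h.scaledOscDiff (cos_three_quarterMesh α k) (by simp [evenMask₄]) (by simp [oddMask₄])
    ?_ ?_ <;>
    ext j <;> fin_cases j <;>
    simp [evenMask₂, evenMask₄, oddMask₂, oddMask₄, polyT] <;> ring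

theorem exists_bound_scaledDiff (h : ∃ M, ∀ n, |F 0 n| ≤ M) : ∃ M, ∀ n, |scaledDiff F 0 n| ≤ M := by
  obtain ⟨M, hM⟩ := h
  refine ⟨2 * M, fun n => ?_⟩
  have h1 := abs_le.1 (hM n)
  have h2 := abs_le.1 (hM (n + 1))
  rw [scaledDiff, pow_zero, one_mul, abs_le]
  constructor <;> linarith [h1.1, h1.2, h2.1, h2.2]

theorem exists_bound_scaledOscDiff (θ : ℝ) (h : ∃ M, ∀ n, |F 0 n| ≤ M) :
    ∃ M, ∀ n, |scaledOscDiff θ F 0 n| ≤ M := by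
  obtain ⟨M, hM⟩ := h
  refine ⟨4 * M, fun n => ?_⟩
  have h0 := abs_le.1 (hM n)
  have h2 := abs_le.1 (hM (n + 2))
  have h1 : |2 * Real.cos (θ / 2 ^ 0) * F 0 (n + 1)| ≤ 2 * M := by
    rw [abs_mul, abs_mul, abs_two]
    have := Real.abs_cos_le_one (θ / 2 ^ 0)
    have hM0 : 0 ≤ M := (abs_nonneg _).trans (hM 0)
    calc 2 * |Real.cos (θ / 2 ^ 0)| * |F 0 (n + 1)| ≤ 2 * 1 * M := by gcongr; exact hM _
      _ = 2 * M := by ring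
  have h1 := abs_le.1 h1
  rw [scaledOscDiff, pow_zero, one_mul, abs_le]
  constructor <;> linarith [h0.1, h0.2, h1.1, h1.2, h2.1, h2.2]

theorem exists_regularLimit_of_masks {a b : ℝ → Fin 4 → ℝ} {ρ : ℝ} (hρ : ρ < 1)
    (hab : IsContractiveRule (a 0) (b 0) ρ)
    (ha : ∀ j, DifferentiableAt ℝ (fun u => a u j) 0)
    (hb : ∀ j, DifferentiableAt ℝ (fun u => b u j) 0)
    (hF : ∀ k, IsRefinement (a (quarterMesh α k)) (b (quarterMesh α k)) (F k) (F (k + 1)))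
    (h0 : ∃ M, ∀ n, |F 0 n| ≤ M) : ∃ g, RegularLimit F g := by
  obtain ⟨M, hM⟩ := h0
  exact exists_regularLimit_of_refinement hρ hab hF hM
    (fun j => summable_abs_sub_of_differentiableAt (ha j) α)
    (fun j => summable_abs_sub_of_differentiableAt (hb j) α)

end Scheme

/-! ### From oscillatory differences to four derivatives. -/

/-- By 2 - 2 cos 2t = 4 sin² t, the sequence is the square of the difference quotient of sin (θx) at
0 with step 2^-(k+1). -/
theorem tendsto_four_pow_mul_cos (θ : ℝ) :
    Tendsto (fun k : ℕ => (4 : ℝ) ^ k * (2 - 2 * Real.cos (θ / 2 ^ k))) atTop (nhds (θ ^ 2)) := by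
  have hd : HasDerivAt (fun x : ℝ => Real.sin (θ * x)) θ 0 := by
    simpa using ((hasDerivAt_id (0 : ℝ)).const_mul θ).sin
  have hu : Tendsto (fun k : ℕ => (1 : ℝ) / 2 ^ (k + 1)) atTop (nhdsWithin 0 {0}ᶜ) := by
    rw [tendsto_nhdsWithin_iff]
    refine ⟨?_, Eventually.of_forall fun k => by simp⟩
    have := (tendsto_pow_atTop_nhds_zero_of_lt_one (r := (1 / 2 : ℝ)) (by norm_num)
      (by norm_num)).comp (tendsto_add_atTop_nat 1)
    simpa [Function.comp_def] using this
  have h1 := (hd.tendsto_slope_zero.comp hu).pow 2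
  refine h1.congr fun k => ?_
  have h2 : Real.cos (θ / 2 ^ k) = 1 - 2 * Real.sin (θ / 2 ^ (k + 1)) ^ 2 := by
    have h3 : θ / 2 ^ k = 2 * (θ / 2 ^ (k + 1)) := by rw [pow_succ]; field_simp
    rw [h3, Real.cos_two_mul, Real.sin_sq]; ring
  have h4 : (4 : ℝ) ^ k = (2 ^ k) ^ 2 := by rw [← pow_mul, mul_comm, pow_mul]; norm_num
  simp only [Function.comp_apply, smul_eq_mul, zero_add, mul_zero, Real.sin_zero, sub_zero]
  rw [h2, h4, mul_one_div, pow_succ]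
  field_simp
  ring

/-- The second differences of a sequence with limit `g` whose oscillatory differences have limit
`G` have the limit `G - θ² g`. -/
theorem RegularLimit.scaledDiff_scaledDiff {F : ℕ → ℤ → ℝ} {g G : ℝ → ℝ} {θ : ℝ}
    (h : RegularLimit F g) (hG : RegularLimit (scaledOscDiff θ F) G) :
    DyadicLimit (scaledDiff (scaledDiff F)) fun x => G x - θ ^ 2 * g x := by
  obtain ⟨M, hM⟩ := h.bounded
  have hM0 : 0 ≤ M := (abs_nonneg _).trans (hM 0 0)
  intro ε hε
  have hκ : ∀ᶠ k : ℕ in atTop,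
      |(4 : ℝ) ^ k * (2 - 2 * Real.cos (θ / 2 ^ k)) - θ ^ 2| < ε / 3 / (M + 1) := by
    have := Metric.tendsto_nhds.1 (tendsto_four_pow_mul_cos θ) (ε / 3 / (M + 1)) (by positivity)
    simpa only [Real.dist_eq] using this
  filter_upwards [hκ, hG.limit (ε / 3) (by linarith),
    h.limit_shift (ε / 3 / (θ ^ 2 + 1)) (by positivity)] with k h1 h2 h3 i
  have h2 := h2 i
  have h3 := h3 i
  set x := (i : ℝ) / 2 ^ k
  set κ := (4 : ℝ) ^ k * (2 - 2 * Real.cos (θ / 2 ^ k)) with hκdef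
  -- The second difference is the oscillatory one minus κ F k (i + 1), with κ → θ²; the middle index
  -- i + 1 is why the shifted limit is needed.
  have e : scaledDiff (scaledDiff F) k i - (G x - θ ^ 2 * g x)
      = (scaledOscDiff θ F k i - G x) + -((κ - θ ^ 2) * F k (i + 1))
        + -(θ ^ 2 * (F k (i + 1) - g x)) := by
    have h4 : (4 : ℝ) ^ k = 2 ^ k * 2 ^ k := by rw [← mul_pow]; norm_num
    simp only [scaledDiff, scaledOscDiff, hκdef, h4, add_assoc, one_add_one_eq_two]
    ring
  have b1 : |(κ - θ ^ 2) * F k (i + 1)| ≤ ε / 3 := by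
    rw [abs_mul]
    calc _ ≤ ε / 3 / (M + 1) * (M + 1) := by
          gcongr; exact (hM k (i + 1)).trans (by linarith)
      _ = ε / 3 := by field_simp
  have b2 : |θ ^ 2 * (F k (i + 1) - g x)| ≤ ε / 3 := by
    rw [abs_mul, abs_of_nonneg (sq_nonneg θ)]
    calc _ ≤ (θ ^ 2 + 1) * (ε / 3 / (θ ^ 2 + 1)) := by gcongr; linarith
      _ = ε / 3 := by field_simp
  rw [e]
  refine (abs_add_three _ _ _).trans ?_
  rw [abs_neg, abs_neg]
  linarith

theorem RegularLimit.hasDerivAt {F : ℕ → ℤ → ℝ} {g g₁ : ℝ → ℝ} (h : RegularLimit F g)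
    (h₁ : DyadicLimit (scaledDiff F) g₁) (hg₁ : Continuous g₁) (x : ℝ) : HasDerivAt g (g₁ x) x :=
  h.limit.hasDerivAt h₁ h.continuous hg₁ x

theorem contDiff_succ_of_hasDerivAt {n : ℕ} {g g' : ℝ → ℝ} (h : ∀ x, HasDerivAt g (g' x) x)
    (hg' : ContDiff ℝ n g') : ContDiff ℝ (n + 1 : ℕ) g := by
  have hd : deriv g = g' := funext fun x => (h x).deriv
  push_cast
  rw [contDiff_succ_iff_deriv]
  exact ⟨fun x => (h x).differentiableAt, by simp, hd ▸ hg'⟩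

/-- Limits of sequences refined by the masks of the scheme exist and are of class `C⁴`. -/
theorem exists_contDiff_dyadicLimit {α : ℝ} {F : ℕ → ℤ → ℝ}
    (hF : ∀ k, IsRefinement (evenMask₀ (quarterMesh α k)) (oddMask₀ (quarterMesh α k))
      (F k) (F (k + 1))) (h0 : ∃ M, ∀ n, |F 0 n| ≤ M) :
    ∃ g, ContDiff ℝ 4 g ∧ DyadicLimit F g := by
  have hρ : (11 / 12 : ℝ) < 1 := by norm_num
  have hF₂ := fun k => isRefinement_masks₂ (hF k)
  have h2 := exists_bound_scaledOscDiff α h0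
  obtain ⟨g, hg⟩ := exists_regularLimit_of_masks hρ isContractiveRule_masks₀
    (differentiableAt_mask (by simp)) (differentiableAt_mask (by simp)) hF h0
  obtain ⟨g₁, hg₁⟩ := exists_regularLimit_of_masks hρ isContractiveRule_masks₁
    (differentiableAt_mask (by simp)) (differentiableAt_mask (by simp))
    (fun k => isRefinement_masks₁ (hF k)) (exists_bound_scaledDiff h0)
  obtain ⟨g₂, hg₂⟩ := exists_regularLimit_of_masks hρ isContractiveRule_masks₂
    (differentiableAt_mask (by simp)) (differentiableAt_mask (by simp)) hF₂ h2
  obtain ⟨g₃, hg₃⟩ := exists_regularLimit_of_masks hρ isContractiveRule_masks₃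
    (differentiableAt_mask (by simp)) (differentiableAt_mask (by simp))
    (fun k => isRefinement_masks₃ (hF₂ k)) (exists_bound_scaledDiff h2)
  obtain ⟨g₄, hg₄⟩ := exists_regularLimit_of_masks hρ isContractiveRule_masks₄
    (differentiableAt_mask (by simp)) (differentiableAt_mask (by simp))
    (fun k => isRefinement_masks₄ (hF₂ k)) (exists_bound_scaledOscDiff (3 * α) h2)
  have c0 := hg.continuous
  have c2 := hg₂.continuous
  have c4 := hg₄.continuous
  have d0 := hg.hasDerivAt hg₁.limit hg₁.continuous
  have d1 := hg₁.hasDerivAt (hg.scaledDiff_scaledDiff hg₂) (by fun_prop)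
  have d2 := hg₂.hasDerivAt hg₃.limit hg₃.continuous
  have d3 := hg₃.hasDerivAt (hg₂.scaledDiff_scaledDiff hg₄) (by fun_prop)
  -- Bootstrap: g₂ and g are first shown to be C², so g₁' = g₂ - α² g is C², which makes g₁ of class
  -- C³ and g of class C⁴.
  have s3 : ContDiff ℝ (1 : ℕ) g₃ := contDiff_succ_of_hasDerivAt d3 (n := 0)
    (contDiff_zero.2 (by fun_prop))
  have s2 : ContDiff ℝ (2 : ℕ) g₂ := contDiff_succ_of_hasDerivAt d2 s3
  have r1 : ContDiff ℝ (1 : ℕ) g₁ := contDiff_succ_of_hasDerivAt d1 (n := 0)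
    (contDiff_zero.2 (by fun_prop))
  have r0 : ContDiff ℝ (2 : ℕ) g := contDiff_succ_of_hasDerivAt d0 r1
  have s1 : ContDiff ℝ (3 : ℕ) g₁ := contDiff_succ_of_hasDerivAt d1
    (s2.sub (contDiff_const.mul r0))
  exact ⟨g, contDiff_succ_of_hasDerivAt d0 s1, hg.limit⟩

/-! ### A nonzero limit, and the theorem. -/

/-- The common sum of the even and of the odd mask coefficients. -/
noncomputable def maskSum (u : ℝ) : ℝ := ∑ j, evenMask₀ u j

/-- From 4u < π/3 follows cos 4u > 1/2, which makes both the factor 4 cos² 4u - 1 in the scale and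
cos 6u = C (2 cos 4u - 1) positive. -/
theorem maskSum_pos {α : ℝ} (hα : α ∈ Set.Ioo 0 (Real.pi / 3)) (k : ℕ) :
    0 < maskSum (quarterMesh α k) := by
  set u := quarterMesh α k with hu
  have hu0 : 0 < u := quarterMesh_pos hα.1 k
  have hu1 : 4 * u < Real.pi / 3 := four_mul_quarterMesh_lt hα k
  have hpi := Real.pi_pos
  have hc1 : 0 < Real.cos u := Real.cos_pos_of_mem_Ioo ⟨by linarith, by linarith⟩
  have hC : 0 < Real.cos (2 * u) := Real.cos_pos_of_mem_Ioo ⟨by linarith, by linarith⟩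
  have hy : 1 / 2 < 2 * Real.cos (2 * u) ^ 2 - 1 := by
    rw [← cos_four_mul, ← Real.cos_pi_div_three]
    exact Real.cos_lt_cos_of_nonneg_of_le_pi (by linarith) (by linarith) hu1
  have hE : 0 < cosTriple u := by
    rw [cosTriple, show 4 * Real.cos (2 * u) ^ 3 - 3 * Real.cos (2 * u)
      = Real.cos (2 * u) * (4 * Real.cos (2 * u) ^ 2 - 3) by ring]
    exact mul_pos hC (by linarith)
  have hb : 0 < residualCoeff u := by unfold residualCoeff; positivity
  have hscale : 0 < maskScale u := by
    have h1 : 0 < 2 * Real.cos (2 * u) ^ 2 - 1 := by linarith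
    have h2 : 0 < 4 * (2 * Real.cos (2 * u) ^ 2 - 1) ^ 2 - 1 := by nlinarith
    unfold maskScale; positivity
  unfold maskSum
  refine Finset.sum_pos (fun j _ => ?_) Finset.univ_nonempty
  fin_cases j <;> simp [evenMask₀, polyQ] <;> positivity

theorem summable_log_maskSum (α : ℝ) :
    Summable fun k => Real.log (maskSum (quarterMesh α k)) := by
  have h1 : maskSum 0 = 1 := isContractiveRule_masks₀.sum_even
  have hd : DifferentiableAt ℝ (fun u => Real.log (maskSum u)) 0 :=
    DifferentiableAt.log (DifferentiableAt.fun_sum fun j _ => differentiableAt_mask (by simp) j)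
      (by rw [h1]; exact one_ne_zero)
  have := summable_abs_sub_of_differentiableAt hd α
  simp only [h1, Real.log_one, sub_zero] at this
  exact this.of_abs

/-- Even and odd masks have the same sum, so constant data stay constant in the index, although the
constant changes from level to level. -/
theorem controlPoints_one {α : ℝ} (hα : α ∈ Set.Ioo 0 (Real.pi / 3)) (k : ℕ) (n : ℤ) :
    controlPoints (fourPointScheme α) (fun _ => 1) k n
      = Real.exp (∑ i ∈ Finset.range k, Real.log (maskSum (quarterMesh α i))) := by
  induction k generalizing n with
  | zero => simp [controlPoints]
  | succ k ih =>
    have h := isRefinement_masks₀ hα (controlPoints (fourPointScheme α) (fun _ => 1) k) k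
    have hodd : ∑ j, oddMask₀ (quarterMesh α k) j = maskSum (quarterMesh α k) := by
      simp only [maskSum, Fin.sum_univ_four, oddMask₀, evenMask₀, Matrix.cons_val]; ring
    rw [Finset.sum_range_succ, Real.exp_add, Real.exp_log (maskSum_pos hα k), controlPoints]
    rcases Int.even_or_odd' n with ⟨m, rfl | rfl⟩
    · rw [(h m).1]
      simp only [ih, ← Finset.sum_mul]
      rw [mul_comm]; rfl
    · rw [(h m).2]
      simp only [ih, ← Finset.sum_mul]
      rw [hodd, mul_comm]

theorem exists_bound_of_memℓp {f : ℤ → ℝ} (hf : Memℓp f ⊤) : ∃ M, ∀ n, |f n| ≤ M := by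
  obtain ⟨M, hM⟩ := memℓp_infty_iff.1 hf
  exact ⟨M, fun n => hM ⟨n, rfl⟩⟩

theorem exists_contDiff_isLimitFunction {α : ℝ} (hα : α ∈ Set.Ioo 0 (Real.pi / 3)) {f₀ : ℤ → ℝ}
    (hf : Memℓp f₀ ⊤) : ∃ g, ContDiff ℝ 4 g ∧ IsLimitFunction (fourPointScheme α) f₀ g := by
  obtain ⟨g, hg, hl⟩ := exists_contDiff_dyadicLimit (α := α)
    (F := controlPoints (fourPointScheme α) f₀)
    (fun k => isRefinement_masks₀ hα _ k) (exists_bound_of_memℓp hf)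
  exact ⟨g, hg, hg.continuous, hl⟩

theorem theorem5p1p5 (α : ℝ) (hα : α ∈ Set.Ioo 0 (Real.pi / 3)) :
    IsConvergentScheme (fourPointScheme α) ∧ HasSmoothLimits 4 (fourPointScheme α) := by
  refine ⟨⟨fun f₀ hf => ?_, ?_⟩, fun f₀ g hf hg => ?_⟩
  · obtain ⟨g, -, hg⟩ := exists_contDiff_isLimitFunction hα hf
    exact ⟨g, hg⟩
  · have h1 : Memℓp (fun _ : ℤ => (1 : ℝ)) ⊤ :=
      memℓp_infty ⟨1, by rintro _ ⟨_, rfl⟩; simp⟩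
    obtain ⟨g, -, hg⟩ := exists_contDiff_isLimitFunction hα h1
    refine ⟨_, g, h1, hg, fun h0 => ?_⟩
    have hlim := DyadicLimit.tendsto hg.2 hg.1 0
    simp only [controlPoints_one hα] at hlim
    -- The values at 0 converge to the exponential of a convergent series, which cannot vanish.
    have hexp := (Real.continuous_exp.tendsto _).comp
      (summable_log_maskSum α).hasSum.tendsto_sum_nat
    have := tendsto_nhds_unique hlim hexp
    rw [h0, Pi.zero_apply] at this
    exact (Real.exp_pos _).ne this
  · obtain ⟨g', hg', hl⟩ := exists_contDiff_isLimitFunction hα hf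
    -- Smoothness is claimed for every limit function, so `g` is identified with the smooth one
    -- constructed.
    rw [DyadicLimit.unique hg.2 hl.2 hg.1 hl.1]
    exact_mod_cast hg'
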